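/- Write $(a;q)_n=\prod_{j=0}^{n-1}(1-aq^j)$ and $(a;q)_\infty=\lim_{n\to\infty}(a;q)_n$. (a) For every complex $q$ with $|q|<1$, both of the following series converge absolutely and $$\sum_{n=0}^{\infty} q^n\,(q^{n+1};q)_n\,(q^{2n+2};q^2)_\infty=\sum_{j=0}^{\infty}(-1)^j q^{j(3j+2)}\,(1+q^{2j+1}).$$ (b) For $n\ge 0$, consider the partitions of $n$ into distinct non-negative parts, with at least one part, in which each odd part is less than twice the smallest part; here $0$ is allowed as a part (at most once, and then it is the smallest part) and is counted as a part. Let $d_o(n)$ be the number of such partitions with an odd number of parts and $d_e(n)$ the number of such partitions with an even number of parts. Then $$d_o(n)-d_e(n)=\begin{cases}(-1)^j, & \text{if } n=3j^2+2j \text{ or } n=3j^2+4j+1 \text{ for some integer } j\ge 0,\\ 0, & \text{otherwise.}\end{cases}$$ -/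

import Mathlib

noncomputable section

/-- The finite `q`-Pochhammer symbol `(a;q)_n = ∏_{j=0}^{n-1} (1 - a q^j)`. -/
def qPoch (a q : ℂ) (n : ℕ) : ℂ :=
  ∏ j ∈ Finset.range n, (1 - a * q ^ j)

/-- The infinite `q`-Pochhammer symbol `(a;q)_∞ = lim_{n → ∞} (a;q)_n`. -/
def qPochInf (a q : ℂ) : ℂ :=
  Filter.limUnder Filter.atTop (fun n : ℕ => qPoch a q n)

/-- For `|q| < 1` the limit that defines `(a;q)_∞` exists. -/
theorem tendsto_qPoch_qPochInf (a q : ℂ) (hq : ‖q‖ < 1) :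
    Filter.Tendsto (fun n : ℕ => qPoch a q n) Filter.atTop (nhds (qPochInf a q)) := by
  refine tendsto_nhds_limUnder ?_
  have hs : Summable (fun j : ℕ => ‖-(a * q ^ j)‖) := by
    simp only [norm_neg, norm_mul, norm_pow]
    exact (summable_geometric_of_lt_one (norm_nonneg q) hq).mul_left _
  have hm := (multipliable_one_add_of_summable hs).tendsto_prod_tprod_nat
  exact ⟨_, by simpa [qPoch, sub_eq_add_neg] using hm⟩

/-- `s` is the set of parts of a partition of `n` into distinct non-negative parts (so `0` may
occur, at most once, and it then is the smallest part and counts as a part), having at least one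
part, in which each odd part is less than twice the smallest part. -/
def IsOddBoundedDistinctPartition (n : ℕ) (s : Finset ℕ) : Prop :=
  ∃ hs : s.Nonempty, ∑ p ∈ s, p = n ∧ ∀ p ∈ s, Odd p → p < 2 * s.min' hs

/-- There are finitely many such partitions of `n`, so the cardinalities below are genuine. -/
theorem finite_isOddBoundedDistinctPartition (n : ℕ) :
    {s : Finset ℕ | IsOddBoundedDistinctPartition n s}.Finite := by
  refine (Finset.range (n + 1)).powerset.finite_toSet.subset ?_
  rintro s ⟨_, hsum, _⟩
  simp only [Finset.coe_powerset, Set.mem_preimage, Set.mem_powerset_iff, Finset.coe_subset]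
  intro p hp
  have := Finset.single_le_sum (f := fun p : ℕ => p) (fun _ _ => Nat.zero_le _) hp
  simp only [Finset.mem_range]
  omega

/-- `d_o(n)`: the number of such partitions of `n` with an odd number of parts. -/
def dOdd (n : ℕ) : ℕ :=
  {s : Finset ℕ | IsOddBoundedDistinctPartition n s ∧ Odd s.card}.ncard

/-- `d_e(n)`: the number of such partitions of `n` with an even number of parts. -/
def dEven (n : ℕ) : ℕ :=
  {s : Finset ℕ | IsOddBoundedDistinctPartition n s ∧ Even s.card}.ncard

end

/-! Both halves rest on the intermediate series `∑ (q;q²)_m q^m`. Since `(q^(n+1);q)_n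
(q^(2n+2);q²)_∞ = (q;q)_∞ / ((q;q)_n (q^(2n+1);q²)_∞)`, Euler's expansion of the last factor turns
the left side into `(q;q)_∞` times the double series of `q^(n+m+2nm) / ((q;q)_n (q²;q²)_m)`. Summing
over `n` first, again by Euler, leaves the intermediate series (`hasSum_qPoch_mul_qPochInf`). With
`Q = q²`, `S(x) = ∑ (x;Q)_n x^n` satisfies `S(x) = 1 + x - x³Q S(xQ)`; iterating from `x = q` gives
the false theta series. For (b), expanding the products, with `q^n` recording the smallest part `n`,
shows that the left side generates `dOdd - dEven`; uniqueness of power series coefficients finishes.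
-/

open Filter Topology in
theorem summable_of_norm_succ_eq {E : Type*} [SeminormedAddCommGroup E] [CompleteSpace E]
    {f : ℕ → E} {u : ℕ → ℝ} {c : ℝ} (hc : c < 1) (hu : Tendsto u atTop (𝓝 c))
    (h : ∀ n, ‖f (n + 1)‖ = u n * ‖f n‖) : Summable f := by
  obtain ⟨r, hcr, hr⟩ := exists_between hc
  refine summable_of_ratio_norm_eventually_le hr ?_
  filter_upwards [hu.eventually (gt_mem_nhds hcr)] with n hn
  rw [h n]
  exact mul_le_mul_of_nonneg_right hn.le (norm_nonneg _)

/-! ### Splitting q-Pochhammer symbols -/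

@[simp] theorem qPoch_zero (a q : ℂ) : qPoch a q 0 = 1 := by simp [qPoch]

theorem qPoch_succ (a q : ℂ) (n : ℕ) : qPoch a q (n + 1) = qPoch a q n * (1 - a * q ^ n) := by
  simp [qPoch, Finset.prod_range_succ]

theorem qPoch_add (a q : ℂ) (m n : ℕ) :
    qPoch a q (m + n) = qPoch a q m * qPoch (a * q ^ m) q n := by
  simp [qPoch, Finset.prod_range_add, pow_add, mul_assoc]

theorem qPoch_succ' (a q : ℂ) (n : ℕ) : qPoch a q (n + 1) = (1 - a) * qPoch (a * q) q n := by
  rw [add_comm, qPoch_add]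
  simp [qPoch]

theorem qPoch_two_mul (a q : ℂ) (n : ℕ) :
    qPoch a q (2 * n) = qPoch a (q ^ 2) n * qPoch (a * q) (q ^ 2) n := by
  induction n with
  | zero => simp
  | succ n ih =>
    rw [show 2 * (n + 1) = 2 * n + 1 + 1 by ring, qPoch_succ, qPoch_succ, ih, qPoch_succ, qPoch_succ]
    ring

theorem norm_pow_lt_one {q : ℂ} (hq : ‖q‖ < 1) {n : ℕ} (hn : n ≠ 0) : ‖q ^ n‖ < 1 := by
  rw [norm_pow]
  exact pow_lt_one₀ (norm_nonneg q) hq hn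

theorem qPoch_mul_qPochInf (a : ℂ) {q : ℂ} (hq : ‖q‖ < 1) (m : ℕ) :
    qPoch a q m * qPochInf (a * q ^ m) q = qPochInf a q := by
  have h := (tendsto_qPoch_qPochInf (a * q ^ m) q hq).const_mul (qPoch a q m)
  simp only [← qPoch_add] at h
  refine tendsto_nhds_unique h ?_
  have h' := (Filter.tendsto_add_atTop_iff_nat m).2 (tendsto_qPoch_qPochInf a q hq)
  simpa only [add_comm] using h'

theorem qPochInf_sq_mul_qPochInf_sq (a : ℂ) {q : ℂ} (hq : ‖q‖ < 1) :
    qPochInf a (q ^ 2) * qPochInf (a * q) (q ^ 2) = qPochInf a q := by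
  have hq2 := norm_pow_lt_one hq two_ne_zero
  have h := (tendsto_qPoch_qPochInf a _ hq2).mul (tendsto_qPoch_qPochInf (a * q) _ hq2)
  simp only [← qPoch_two_mul] at h
  exact tendsto_nhds_unique h ((tendsto_qPoch_qPochInf a q hq).comp
    (Filter.tendsto_id.const_mul_atTop' two_pos))

theorem qPoch_self_ne_zero {q : ℂ} (hq : ‖q‖ < 1) (n : ℕ) : qPoch q q n ≠ 0 := by
  refine Finset.prod_ne_zero_iff.2 fun j _ h => ?_
  have h1 : q ^ (j + 1) = 1 := by rw [pow_succ']; exact (sub_eq_zero.1 h).symm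
  have h2 := norm_pow_lt_one hq j.succ_ne_zero
  rw [Nat.succ_eq_add_one, h1, norm_one] at h2
  exact lt_irrefl _ h2

open Filter Topology in
theorem tendsto_one_sub_mul_pow (a : ℂ) {q : ℂ} (hq : ‖q‖ < 1) :
    Tendsto (fun n : ℕ => 1 - a * q ^ n) atTop (𝓝 1) := by
  simpa using ((tendsto_pow_atTop_nhds_zero_of_norm_lt_one hq).const_mul a).const_sub 1

/-! ### Euler's expansion of `1 / (z;q)_∞` -/

/-- Euler's series `∑ zⁿ / (q;q)_n`. -/
noncomputable def eulerSeries (q z : ℂ) : ℂ := ∑' n : ℕ, z ^ n / qPoch q q n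

theorem summable_eulerSeries {q z : ℂ} (hq : ‖q‖ < 1) (hz : ‖z‖ < 1) :
    Summable fun n : ℕ => z ^ n / qPoch q q n := by
  refine summable_of_norm_succ_eq (u := fun n => ‖z / (1 - q * q ^ n)‖) hz ?_ fun n => ?_
  · simpa using ((tendsto_const_nhds (x := z)).div (tendsto_one_sub_mul_pow q hq) one_ne_zero).norm
  · rw [← norm_mul, qPoch_succ, pow_succ]
    congr 1
    simp only [div_eq_mul_inv, mul_inv]
    ring

theorem one_sub_mul_eulerSeries {q z : ℂ} (hq : ‖q‖ < 1) (hz : ‖z‖ < 1) :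
    (1 - z) * eulerSeries q z = eulerSeries q (z * q) := by
  have hzq : ‖z * q‖ < 1 := by
    rw [norm_mul]; exact mul_lt_one_of_nonneg_of_lt_one_left (norm_nonneg _) hz hq.le
  have h1 := summable_eulerSeries hq hz
  have h2 := summable_eulerSeries hq hzq
  have h3 : eulerSeries q z - eulerSeries q (z * q) = z * eulerSeries q z := by
    unfold eulerSeries
    rw [← h1.tsum_sub h2, (h1.sub h2).tsum_eq_zero_add, ← tsum_mul_left]
    simp only [pow_zero, sub_self, zero_add]
    refine tsum_congr fun n => ?_
    have h4 := qPoch_self_ne_zero hq (n + 1)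
    rw [qPoch_succ] at h4 ⊢
    have h5 := right_ne_zero_of_mul h4
    have h6 := left_ne_zero_of_mul h4
    field_simp
    ring
  linear_combination h3

-- Iterating the functional equation gives `(z;q)_n E(z) = E(z q^n)`, where `E` is Euler's series,
-- and `E(z q^n)` tends to `E(0) = 1`.
open Filter Topology in
theorem qPochInf_mul_eulerSeries {q z : ℂ} (hq : ‖q‖ < 1) (hz : ‖z‖ < 1) :
    qPochInf z q * eulerSeries q z = 1 := by
  have hle : ∀ n : ℕ, ‖z * q ^ n‖ ≤ ‖z‖ := fun n => by
    rw [norm_mul, norm_pow]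
    exact mul_le_of_le_one_right (norm_nonneg _) (pow_le_one₀ (norm_nonneg _) hq.le)
  have h1 : ∀ n : ℕ, qPoch z q n * eulerSeries q z = eulerSeries q (z * q ^ n) := fun n => by
    induction n with
    | zero => simp
    | succ n ih =>
      rw [qPoch_succ, mul_right_comm, ih, mul_comm,
        one_sub_mul_eulerSeries hq ((hle n).trans_lt hz), pow_succ, mul_assoc]
  have h2 : Tendsto (fun n : ℕ => eulerSeries q (z * q ^ n)) atTop (𝓝 (eulerSeries q 0)) := by
    refine tendsto_tsum_of_dominated_convergence (summable_eulerSeries hq hz).norm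
      (fun k => ?_) (Eventually.of_forall fun n k => ?_)
    · refine Tendsto.div_const (Tendsto.pow ?_ k) _
      simpa using (tendsto_pow_atTop_nhds_zero_of_norm_lt_one hq).const_mul z
    · rw [norm_div, norm_div, norm_pow, norm_pow]
      gcongr
      exact hle n
  have h3 : eulerSeries q 0 = 1 := by
    unfold eulerSeries
    rw [tsum_eq_single 0 fun n hn => by simp [hn]]
    simp
  rw [h3] at h2
  refine tendsto_nhds_unique ((tendsto_qPoch_qPochInf z q hq).mul_const _) ?_
  simpa only [h1] using h2

theorem qPochInf_self_mul_eulerSeries {q : ℂ} (hq : ‖q‖ < 1) (m : ℕ) :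
    qPochInf q q * eulerSeries q (q ^ (m + 1)) = qPoch q q m := by
  have h := qPochInf_mul_eulerSeries hq (norm_pow_lt_one hq m.succ_ne_zero)
  rw [← qPoch_mul_qPochInf q hq m, mul_assoc, ← pow_succ', h, mul_one]

/-- Cut `(q;q)_∞` after `n` and `2n` factors and split the tail by parity of exponent; Euler's
series cancels the odd part. -/
theorem qPochInf_self_mul_eulerSeries_sq {q : ℂ} (hq : ‖q‖ < 1) (n : ℕ) :
    qPochInf q q * eulerSeries (q ^ 2) (q ^ (2 * n + 1)) =
      qPoch q q n * (qPoch (q ^ (n + 1)) q n * qPochInf (q ^ (2 * n + 2)) (q ^ 2)) := by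
  have h := qPochInf_mul_eulerSeries (norm_pow_lt_one hq two_ne_zero)
    (norm_pow_lt_one hq (2 * n).succ_ne_zero)
  have h1 := qPoch_mul_qPochInf q hq (2 * n)
  have h2 := qPoch_add q q n n
  rw [← two_mul] at h2
  rw [← qPochInf_sq_mul_qPochInf_sq _ hq, h2, ← pow_succ', ← pow_succ', ← pow_succ] at h1
  rw [← h1]
  linear_combination (qPoch q q n * qPoch (q ^ (n + 1)) q n *
    qPochInf (q ^ (2 * n + 2)) (q ^ 2)) * h

/-! ### Interchanging the double series -/

theorem hasSum_qPoch_mul_qPochInf {q : ℂ} (hq : ‖q‖ < 1) :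
    HasSum (fun n : ℕ => q ^ n * qPoch (q ^ (n + 1)) q n * qPochInf (q ^ (2 * n + 2)) (q ^ 2))
      (∑' m : ℕ, qPoch q (q ^ 2) m * q ^ m) := by
  have hq2 := norm_pow_lt_one hq two_ne_zero
  let a : ℕ × ℕ → ℂ := fun x =>
    (q ^ x.1 / qPoch q q x.1) * (q ^ x.2 / qPoch (q ^ 2) (q ^ 2) x.2) * q ^ (2 * x.1 * x.2)
  have ha : Summable a := by
    refine Summable.of_norm_bounded
      (((summable_eulerSeries hq hq).norm).mul_norm (summable_eulerSeries hq2 hq).norm) fun x => ?_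
    rw [norm_mul, norm_pow]
    exact mul_le_of_le_one_right (norm_nonneg _) (pow_le_one₀ (norm_nonneg _) hq.le)
  have ha' := ha.mul_left (qPochInf q q)
  have h1 : ∀ n, HasSum (fun m => qPochInf q q * a (n, m))
      (q ^ n * qPoch (q ^ (n + 1)) q n * qPochInf (q ^ (2 * n + 2)) (q ^ 2)) := fun n => by
    have h := ((summable_eulerSeries hq2 (norm_pow_lt_one hq (2 * n).succ_ne_zero)).hasSum).mul_left
      (qPochInf q q * (q ^ n / qPoch q q n))
    have e : qPochInf q q * (q ^ n / qPoch q q n) *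
        ∑' i : ℕ, (q ^ (2 * n + 1)) ^ i / qPoch (q ^ 2) (q ^ 2) i =
        q ^ n * qPoch (q ^ (n + 1)) q n * qPochInf (q ^ (2 * n + 2)) (q ^ 2) := by
      have h0 := qPoch_self_ne_zero hq n
      have h2 := qPochInf_self_mul_eulerSeries_sq hq n
      unfold eulerSeries at h2
      rw [mul_right_comm, h2]
      field_simp
    rw [Nat.succ_eq_add_one, e] at h
    refine Eq.mpr (congrArg (HasSum · _) (funext fun m => ?_)) h
    simp only [a]
    ring
  have h2 : ∀ m, HasSum (fun n => qPochInf q q * a (n, m)) (qPoch q (q ^ 2) m * q ^ m) := fun m => by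
    have h := ((summable_eulerSeries hq (norm_pow_lt_one hq (2 * m).succ_ne_zero)).hasSum).mul_left
      (qPochInf q q * (q ^ m / qPoch (q ^ 2) (q ^ 2) m))
    have e : qPochInf q q * (q ^ m / qPoch (q ^ 2) (q ^ 2) m) *
        ∑' i : ℕ, (q ^ (2 * m + 1)) ^ i / qPoch q q i = qPoch q (q ^ 2) m * q ^ m := by
      have h0 := qPoch_self_ne_zero hq2 m
      have h2 := qPochInf_self_mul_eulerSeries hq (2 * m)
      unfold eulerSeries at h2
      rw [mul_right_comm, h2, qPoch_two_mul, ← sq]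
      field_simp
    rw [Nat.succ_eq_add_one, e] at h
    refine Eq.mpr (congrArg (HasSum · _) (funext fun n => ?_)) h
    simp only [a]
    ring
  have h3 := ha'.hasSum.prod_fiberwise h1
  have h4 := ((Equiv.prodComm ℕ ℕ).hasSum_iff.2 ha'.hasSum).prod_fiberwise h2
  rwa [h4.tsum_eq]

/-! ### The functional equation and the false theta series -/

theorem summable_qPoch_mul_pow {Q x : ℂ} (hQ : ‖Q‖ < 1) (hx : ‖x‖ < 1) (a : ℂ) :
    Summable fun n : ℕ => qPoch a Q n * x ^ n := by
  refine summable_of_norm_succ_eq (u := fun n => ‖(1 - a * Q ^ n) * x‖) hx ?_ fun n => ?_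
  · simpa using ((tendsto_one_sub_mul_pow a hQ).mul_const x).norm
  · rw [← norm_mul, qPoch_succ, pow_succ]
    congr 1
    ring

/-- With `G = ∑ (xQ;Q)_n x^n`, pulling `1 - x` out of each later term gives `S(x) = 1 + (1-x)xG`,
and splitting off the last factor gives `(1-x)G = 1 - x²Q S(xQ)`. Eliminate `G`. -/
theorem tsum_qPoch_mul_pow {Q x : ℂ} (hQ : ‖Q‖ < 1) (hx : ‖x‖ < 1) :
    ∑' n : ℕ, qPoch x Q n * x ^ n =
      1 + x - x ^ 3 * Q * ∑' n : ℕ, qPoch (x * Q) Q n * (x * Q) ^ n := by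
  have hxQ : ‖x * Q‖ < 1 := by
    rw [norm_mul]; exact mul_lt_one_of_nonneg_of_lt_one_left (norm_nonneg _) hx hQ.le
  have hg := summable_qPoch_mul_pow hQ hx (x * Q)
  have hg' := summable_qPoch_mul_pow hQ hxQ (x * Q)
  have h1 : ∑' n : ℕ, qPoch x Q n * x ^ n =
      1 + (1 - x) * x * ∑' n : ℕ, qPoch (x * Q) Q n * x ^ n := by
    rw [(summable_qPoch_mul_pow hQ hx x).tsum_eq_zero_add, ← tsum_mul_left]
    simp only [qPoch_zero, pow_zero, mul_one]
    congr 1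
    refine tsum_congr fun n => ?_
    rw [qPoch_succ']
    ring
  have h2 : x ^ 2 * Q * ∑' n : ℕ, qPoch (x * Q) Q n * (x * Q) ^ n =
      x * (∑' n : ℕ, qPoch (x * Q) Q n * x ^ n) -
        ∑' n : ℕ, qPoch (x * Q) Q (n + 1) * x ^ (n + 1) := by
    rw [← tsum_mul_left, ← tsum_mul_left,
      ← (hg.mul_left x).tsum_sub ((summable_nat_add_iff 1).2 hg)]
    refine tsum_congr fun n => ?_
    rw [qPoch_succ]
    ring
  have h3 := hg.tsum_eq_zero_add
  simp only [qPoch_zero, pow_zero, mul_one] at h3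
  rw [h1]
  linear_combination x * h2 + x * h3

theorem sum_add_tsum_qPoch {q : ℂ} (hq : ‖q‖ < 1) (N : ℕ) :
    ∑' n : ℕ, qPoch q (q ^ 2) n * q ^ n =
      ∑ j ∈ Finset.range N, (-1 : ℂ) ^ j * q ^ (j * (3 * j + 2)) * (1 + q ^ (2 * j + 1)) +
        (-1 : ℂ) ^ N * q ^ (N * (3 * N + 2)) *
          ∑' n : ℕ, qPoch (q ^ (2 * N + 1)) (q ^ 2) n * (q ^ (2 * N + 1)) ^ n := by
  induction N with
  | zero => simp
  | succ N ih =>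
    rw [ih, Finset.sum_range_succ, tsum_qPoch_mul_pow (norm_pow_lt_one hq two_ne_zero)
      (norm_pow_lt_one hq (2 * N).succ_ne_zero), Nat.succ_eq_add_one, ← pow_add,
      show 2 * N + 1 + 2 = 2 * (N + 1) + 1 by ring]
    ring

theorem exists_norm_tsum_qPoch_le {q : ℂ} (hq : ‖q‖ < 1) :
    ∃ C : ℝ, ∀ N : ℕ,
      ‖∑' n : ℕ, qPoch (q ^ (2 * N + 1)) (q ^ 2) n * (q ^ (2 * N + 1)) ^ n‖ ≤ C := by
  have hr : ‖((‖q‖ : ℝ) : ℂ)‖ < 1 := by simpa using hq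
  have hs := (summable_qPoch_mul_pow (norm_pow_lt_one hr two_ne_zero) hr (-(‖q‖ : ℂ))).norm
  refine ⟨_, fun N => tsum_of_norm_bounded hs.hasSum fun n => ?_⟩
  have hle : ‖q ^ (2 * N + 1)‖ ≤ ‖q‖ := by
    rw [norm_pow]
    exact pow_le_of_le_one (norm_nonneg _) hq.le (2 * N).succ_ne_zero
  rw [norm_mul, norm_mul, norm_pow _ n, norm_pow _ n, Complex.norm_real, norm_norm]
  gcongr
  unfold qPoch
  rw [norm_prod, norm_prod]
  refine Finset.prod_le_prod (fun _ _ => norm_nonneg _) fun j _ => ?_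
  have h1 : ‖1 - -(‖q‖ : ℂ) * ((‖q‖ : ℂ) ^ 2) ^ j‖ = 1 + ‖q‖ * (‖q‖ ^ 2) ^ j := by
    rw [show 1 - -(‖q‖ : ℂ) * ((‖q‖ : ℂ) ^ 2) ^ j = ((1 + ‖q‖ * (‖q‖ ^ 2) ^ j : ℝ) : ℂ) by
      push_cast; ring, Complex.norm_real, Real.norm_of_nonneg (by positivity)]
  rw [h1]
  refine (norm_sub_le _ _).trans ?_
  rw [norm_one, norm_mul, norm_pow _ j, norm_pow q 2]
  gcongr

theorem summable_falseTheta {q : ℂ} (hq : ‖q‖ < 1) :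
    Summable fun j : ℕ => (-1 : ℂ) ^ j * q ^ (j * (3 * j + 2)) * (1 + q ^ (2 * j + 1)) := by
  refine Summable.of_norm_bounded
    ((summable_geometric_of_lt_one (norm_nonneg q) hq).mul_right 2) fun j => ?_
  rw [norm_mul, norm_mul, norm_pow, norm_neg, norm_one, one_pow, one_mul, norm_pow]
  gcongr ?_ * ?_
  · exact pow_le_pow_of_le_one (norm_nonneg _) hq.le (by nlinarith)
  · refine (norm_add_le _ _).trans ?_
    have := (norm_pow_lt_one hq (2 * j).succ_ne_zero).le
    rw [norm_one]
    linarith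

open Filter Topology in
theorem hasSum_falseTheta {q : ℂ} (hq : ‖q‖ < 1) :
    HasSum (fun j : ℕ => (-1 : ℂ) ^ j * q ^ (j * (3 * j + 2)) * (1 + q ^ (2 * j + 1)))
      (∑' n : ℕ, qPoch q (q ^ 2) n * q ^ n) := by
  rw [(summable_falseTheta hq).hasSum_iff_tendsto_nat]
  obtain ⟨C, hC⟩ := exists_norm_tsum_qPoch_le hq
  rw [tendsto_iff_norm_sub_tendsto_zero]
  refine squeeze_zero (fun _ => norm_nonneg _) (g := fun N => ‖q‖ ^ N * C) (fun N => ?_)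
    (by simpa using (tendsto_pow_atTop_nhds_zero_of_lt_one (norm_nonneg q) hq).mul_const C)
  rw [sum_add_tsum_qPoch hq N, sub_add_cancel_left, norm_neg, norm_mul, norm_mul, norm_pow,
    norm_neg, norm_one, one_pow, one_mul, norm_pow]
  gcongr ?_ * ?_
  · exact pow_le_pow_of_le_one (norm_nonneg _) hq.le (by nlinarith)
  · exact hC N

/-! ### The generating function of the partitions -/

/-- `p` may accompany the smallest part `n` in the partitions counted by `dOdd` and `dEven`. -/
def IsAllowedPart (n p : ℕ) : Prop := n < p ∧ (Odd p → p < 2 * n)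

open Classical in
/-- The contribution `-q ^ p` of an allowed part `p` above the smallest part `n`. -/
noncomputable def partWeight (q : ℂ) (n p : ℕ) : ℂ := if IsAllowedPart n p then -q ^ p else 0

theorem norm_partWeight_le (q : ℂ) (n p : ℕ) : ‖partWeight q n p‖ ≤ ‖q‖ ^ p := by
  unfold partWeight
  split_ifs <;> simp

theorem summable_norm_partWeight {q : ℂ} (hq : ‖q‖ < 1) (n : ℕ) :
    Summable fun p => ‖partWeight q n p‖ :=
  Summable.of_nonneg_of_le (fun _ => norm_nonneg _) (norm_partWeight_le q n)
    (summable_geometric_of_lt_one (norm_nonneg q) hq)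

/-- All parts from `n + 1` to `2n` are allowed; beyond that only the even ones are. -/
theorem prod_range_one_add_partWeight (q : ℂ) (n k : ℕ) :
    ∏ p ∈ Finset.range (2 * n + 1 + 2 * k), (1 + partWeight q n p) =
      qPoch (q ^ (n + 1)) q n * qPoch (q ^ (2 * n + 2)) (q ^ 2) k := by
  induction k with
  | zero =>
    rw [mul_zero, add_zero, show 2 * n + 1 = n + 1 + n by ring, Finset.prod_range_add,
      Finset.prod_eq_one, one_mul, qPoch_zero, mul_one]
    · refine Finset.prod_congr rfl fun i hi => ?_
      have hi := Finset.mem_range.1 hi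
      rw [partWeight, if_pos ⟨by omega, fun ⟨m, hm⟩ => by omega⟩]
      ring
    · intro p hp
      have hp := Finset.mem_range.1 hp
      rw [partWeight, if_neg fun h => by have := h.1; omega, add_zero]
  | succ k ih =>
    rw [show 2 * n + 1 + 2 * (k + 1) = 2 * n + 1 + 2 * k + 1 + 1 by ring, Finset.prod_range_succ,
      Finset.prod_range_succ, ih, qPoch_succ, partWeight, partWeight,
      if_neg fun h => by have := h.2 ⟨n + k, by ring⟩; omega,
      if_pos ⟨by omega, fun ⟨m, hm⟩ => by omega⟩]
    ring

open Filter Topology in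
theorem hasSum_prod_partWeight {q : ℂ} (hq : ‖q‖ < 1) (n : ℕ) :
    HasSum (fun t : Finset ℕ => ∏ p ∈ t, partWeight q n p)
      (qPoch (q ^ (n + 1)) q n * qPochInf (q ^ (2 * n + 2)) (q ^ 2)) := by
  have hs := summable_norm_partWeight hq n
  have hf := summable_finsetProd_of_summable_norm hs
  have h1 := (multipliable_one_add_of_summable hs).tendsto_prod_tprod_nat
  have h2 : Tendsto (fun k : ℕ => 2 * n + 1 + 2 * k) atTop atTop :=
    tendsto_atTop_mono (fun k => by simp only [id]; omega) tendsto_id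
  have h3 := h1.comp h2
  simp only [Function.comp_def, prod_range_one_add_partWeight] at h3
  have h4 := (tendsto_qPoch_qPochInf (q ^ (2 * n + 2)) _ (norm_pow_lt_one hq two_ne_zero)).const_mul
    (qPoch (q ^ (n + 1)) q n)
  rw [tendsto_nhds_unique h4 h3, tprod_one_add hf]
  exact hf.hasSum

theorem summable_prod_partWeight {q : ℂ} (hq : ‖q‖ < 1) :
    Summable fun x : ℕ × Finset ℕ => q ^ x.1 * ∏ p ∈ x.2, partWeight q x.1 p := by
  have hg := summable_geometric_of_lt_one (norm_nonneg q) hq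
  have hf : Summable fun t : Finset ℕ => ∏ p ∈ t, ‖q‖ ^ p :=
    summable_finsetProd_of_summable_norm (by simpa using hg)
  refine Summable.of_norm_bounded (hg.mul_of_nonneg hf (fun n => by positivity)
    fun t => Finset.prod_nonneg fun p _ => by positivity) fun x => ?_
  rw [norm_mul, norm_pow, norm_prod]
  gcongr with p
  exact norm_partWeight_le q x.1 p

theorem hasSum_prod_partWeight_prod {q : ℂ} (hq : ‖q‖ < 1) :
    HasSum (fun x : ℕ × Finset ℕ => q ^ x.1 * ∏ p ∈ x.2, partWeight q x.1 p)
      (∑' m : ℕ, qPoch q (q ^ 2) m * q ^ m) := by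
  have h := (summable_prod_partWeight hq).hasSum
  have h1 := h.prod_fiberwise fun n => (hasSum_prod_partWeight hq n).mul_left (q ^ n)
  simp only [← mul_assoc] at h1
  rwa [h1.unique (hasSum_qPoch_mul_qPochInf hq)] at h

theorem isOddBoundedDistinctPartition_iff_exists (s : Finset ℕ) :
    IsOddBoundedDistinctPartition (∑ p ∈ s, p) s ↔
      ∃ n t, (∀ p ∈ t, IsAllowedPart n p) ∧ insert n t = s := by
  constructor
  · rintro ⟨hs, -, h⟩
    refine ⟨s.min' hs, s.erase (s.min' hs), fun p hp => ?_, Finset.insert_erase (s.min'_mem hs)⟩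
    exact ⟨Finset.min'_lt_of_mem_erase_min' s hs hp, h p (Finset.mem_of_mem_erase hp)⟩
  · rintro ⟨n, t, ht, rfl⟩
    have hmin : (insert n t).min' (Finset.insert_nonempty n t) = n := by
      refine le_antisymm (Finset.min'_le _ _ (Finset.mem_insert_self n t))
        (Finset.le_min' _ _ _ fun p hp => ?_)
      rcases Finset.mem_insert.1 hp with rfl | hp
      · exact le_rfl
      · exact (ht p hp).1.le
    refine ⟨Finset.insert_nonempty n t, rfl, fun p hp ho => ?_⟩
    rw [hmin]
    rcases Finset.mem_insert.1 hp with rfl | hp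
    -- An odd smallest part is positive, hence below twice itself.
    · have := ho.pos
      omega
    · exact (ht p hp).2 ho

/-- The smallest element of the union recovers `n`, and erasing it recovers the other parts. -/
theorem injective_insert_allowed :
    Function.Injective fun x : {x : ℕ × Finset ℕ // ∀ p ∈ x.2, IsAllowedPart x.1 p} =>
      insert x.1.1 x.1.2 := by
  rintro ⟨⟨n, t⟩, h⟩ ⟨⟨m, u⟩, h'⟩ heq
  simp only at h h' heq
  have hn : n ∉ t := fun hn => lt_irrefl _ (h n hn).1
  have hm : m ∉ u := fun hm => lt_irrefl _ (h' m hm).1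
  have h1 : n = m := by
    have hn' : n ∈ insert m u := heq ▸ Finset.mem_insert_self n t
    have hm' : m ∈ insert n t := heq ▸ Finset.mem_insert_self m u
    rcases Finset.mem_insert.1 hn' with h1 | h1
    · exact h1
    rcases Finset.mem_insert.1 hm' with h2 | h2
    · exact h2.symm
    exact absurd (h' n h1).1 (h m h2).1.not_gt
  subst h1
  have h2 : t = u := by rw [← Finset.erase_insert hn, heq, Finset.erase_insert hm]
  subst h2
  rfl

open Classical in
/-- The signed contribution of a set of parts to the generating function of `dOdd - dEven`. -/
noncomputable def signedWeight (q : ℂ) (s : Finset ℕ) : ℂ :=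
  if IsOddBoundedDistinctPartition (∑ p ∈ s, p) s then -(-1) ^ s.card * q ^ ∑ p ∈ s, p else 0

/-- The minus sign in the weight accounts for the smallest part, which enters the series as `+q^n`.
-/
theorem hasSum_signedWeight {q : ℂ} (hq : ‖q‖ < 1) :
    HasSum (signedWeight q) (∑' m : ℕ, qPoch q (q ^ 2) m * q ^ m) := by
  rw [← injective_insert_allowed.hasSum_iff]
  · have h := hasSum_prod_partWeight_prod hq
    rw [← hasSum_subtype_iff_of_support_subset
      (s := {x : ℕ × Finset ℕ | ∀ p ∈ x.2, IsAllowedPart x.1 p})] at h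
    · refine Eq.mpr (congrArg (HasSum · _) (funext ?_)) h
      rintro ⟨⟨n, t⟩, ht⟩
      have hn : n ∉ t := fun hn => lt_irrefl _ (ht n hn).1
      have h1 : ∏ p ∈ t, partWeight q n p = (-1) ^ t.card * q ^ ∑ p ∈ t, p := by
        rw [← Finset.prod_pow_eq_pow_sum, ← Finset.prod_const, ← Finset.prod_mul_distrib]
        exact Finset.prod_congr rfl fun p hp => by rw [partWeight, if_pos (ht p hp), neg_one_mul]
      simp only [Function.comp_apply]
      rw [signedWeight, if_pos ((isOddBoundedDistinctPartition_iff_exists _).2 ⟨n, t, ht, rfl⟩),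
        h1, Finset.card_insert_of_notMem hn, Finset.sum_insert hn]
      ring
    · intro x hx p hp
      by_contra hne
      exact hx (mul_eq_zero_of_right _ (Finset.prod_eq_zero hp (if_neg hne)))
  · intro s hs
    refine if_neg fun h => hs ?_
    obtain ⟨n, t, ht, rfl⟩ := (isOddBoundedDistinctPartition_iff_exists s).1 h
    exact ⟨⟨(n, t), ht⟩, rfl⟩

theorem sum_neg_neg_one_pow_card (n : ℕ) :
    ∑ s ∈ (finite_isOddBoundedDistinctPartition n).toFinset, -(-1 : ℂ) ^ s.card =
      (dOdd n : ℂ) - dEven n := by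
  set F := (finite_isOddBoundedDistinctPartition n).toFinset with hF
  have ho : dOdd n = (F.filter fun s => Odd s.card).card := by
    rw [← Set.ncard_coe_finset, dOdd]
    congr 1
    ext s
    simp [hF]
  have he : dEven n = (F.filter fun s => ¬ Odd s.card).card := by
    rw [← Set.ncard_coe_finset, dEven]
    congr 1
    ext s
    simp [hF]
  rw [← Finset.sum_filter_add_sum_filter_not F fun s => Odd s.card,
    Finset.sum_congr rfl (g := fun _ => (1 : ℂ)) fun s hs => by
      rw [(Finset.mem_filter.1 hs).2.neg_one_pow, neg_neg],
    Finset.sum_congr (s₁ := F.filter fun s => ¬ Odd s.card) rfl (g := fun _ => (-1 : ℂ))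
      fun s hs => by rw [(Nat.not_odd_iff_even.1 (Finset.mem_filter.1 hs).2).neg_one_pow]]
  simp [ho, he, sub_eq_add_neg]

theorem hasSum_dOdd_sub_dEven {q : ℂ} (hq : ‖q‖ < 1) :
    HasSum (fun n : ℕ => q ^ n * ((dOdd n : ℂ) - dEven n))
      (∑' m : ℕ, qPoch q (q ^ 2) m * q ^ m) := by
  have h := (hasSum_signedWeight hq).tsum_fiberwise fun s : Finset ℕ => ∑ p ∈ s, p
  refine Eq.mpr (congrArg (HasSum · _) (funext fun n => ?_)) h
  rw [tsum_subtype, ← sum_neg_neg_one_pow_card, Finset.mul_sum,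
    tsum_eq_sum (s := (finite_isOddBoundedDistinctPartition n).toFinset)]
  · refine Finset.sum_congr rfl fun s hs => ?_
    have hs : IsOddBoundedDistinctPartition n s := by simpa using hs
    obtain ⟨-, hsum, -⟩ := id hs
    rw [Set.indicator_of_mem (by simpa using hsum), signedWeight, hsum, if_pos hs, mul_comm]
  · intro s hs
    rw [Set.indicator_apply_eq_zero]
    intro hsum
    have hsum : ∑ p ∈ s, p = n := by simpa using hsum
    rw [signedWeight, hsum, if_neg (by simpa using hs)]

/-! ### Comparison of coefficients -/

/-- The exponents `3j² + 2j` (for `k = 2j`) and `3j² + 4j + 1` (for `k = 2j + 1`). -/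
def falseThetaExponent (k : ℕ) : ℕ := 3 * (k / 2) ^ 2 + 2 * (k / 2) + k % 2 * (2 * (k / 2) + 1)

theorem falseThetaExponent_two_mul (j : ℕ) : falseThetaExponent (2 * j) = 3 * j ^ 2 + 2 * j := by
  simp [falseThetaExponent]

theorem falseThetaExponent_two_mul_add_one (j : ℕ) :
    falseThetaExponent (2 * j + 1) = 3 * j ^ 2 + 4 * j + 1 := by
  rw [falseThetaExponent, show (2 * j + 1) / 2 = j by omega, show (2 * j + 1) % 2 = 1 by omega]
  ring

theorem strictMono_falseThetaExponent : StrictMono falseThetaExponent := by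
  refine strictMono_nat_of_lt_succ fun k => ?_
  rcases Nat.even_or_odd' k with ⟨j, rfl | rfl⟩
  · rw [falseThetaExponent_two_mul, falseThetaExponent_two_mul_add_one]
    omega
  · rw [show 2 * j + 1 + 1 = 2 * (j + 1) by ring, falseThetaExponent_two_mul,
      falseThetaExponent_two_mul_add_one]
    nlinarith

/-- The coefficients of the false theta series. -/
noncomputable def falseThetaCoeff : ℕ → ℤ :=
  Function.extend falseThetaExponent (fun k => (-1) ^ (k / 2)) 0

theorem hasSum_falseThetaCoeff {q : ℂ} (hq : ‖q‖ < 1) :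
    HasSum (fun n : ℕ => q ^ n * (falseThetaCoeff n : ℂ))
      (∑' m : ℕ, qPoch q (q ^ 2) m * q ^ m) := by
  have hs : ∀ e : ℕ → ℕ, (∀ j, j ≤ e j) → Summable fun j : ℕ => (-1 : ℂ) ^ j * q ^ e j :=
    fun e he => Summable.of_norm_bounded (summable_geometric_of_lt_one (norm_nonneg q) hq)
      fun j => by
        rw [norm_mul, norm_pow, norm_neg, norm_one, one_pow, one_mul, norm_pow]
        exact pow_le_pow_of_le_one (norm_nonneg _) hq.le (he j)
  have h0 := (hs (fun j => 3 * j ^ 2 + 2 * j) fun j => by nlinarith).hasSum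
  have h1 := (hs (fun j => 3 * j ^ 2 + 4 * j + 1) fun j => by nlinarith).hasSum
  have h2 := h0.add h1
  -- Grouping the two exponent families by `j` gives the false theta series; interleaving them over
  -- `k` below has the same sum.
  rw [h2.unique (Eq.mpr (congrArg (HasSum · _) (funext fun j => by ring)) (hasSum_falseTheta hq))]
    at h2
  rw [← strictMono_falseThetaExponent.injective.hasSum_iff]
  · have h3 : HasSum (fun k : ℕ => (-1 : ℂ) ^ (k / 2) * q ^ falseThetaExponent k) _ :=
      HasSum.even_add_odd
        (by simpa only [Nat.mul_div_cancel_left _ two_pos, falseThetaExponent_two_mul] using h0)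
        (by simpa only [falseThetaExponent_two_mul_add_one,
          show ∀ j, (2 * j + 1) / 2 = j by omega] using h1)
    rw [(h0.add h1).unique h2] at h3
    refine Eq.mpr (congrArg (HasSum · _) (funext fun k => ?_)) h3
    simp only [Function.comp_apply]
    rw [falseThetaCoeff, strictMono_falseThetaExponent.injective.extend_apply]
    push_cast
    ring
  · intro n hn
    rw [falseThetaCoeff, Function.extend_apply' _ _ _ fun h => hn h]
    simp

open Filter Topology in
theorem eq_of_hasSum_pow_mul {a b : ℕ → ℂ} {f : ℂ → ℂ}
    (ha : ∀ q : ℂ, ‖q‖ < 1 → HasSum (fun n => q ^ n * a n) (f q))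
    (hb : ∀ q : ℂ, ‖q‖ < 1 → HasSum (fun n => q ^ n * b n) (f q)) : a = b := by
  have key : ∀ c : ℕ → ℂ, (∀ q : ℂ, ‖q‖ < 1 → HasSum (fun n => q ^ n * c n) (f q)) →
      HasFPowerSeriesAt f (FormalMultilinearSeries.ofScalars ℂ c) 0 := fun c hc => by
    rw [hasFPowerSeriesAt_iff]
    filter_upwards [Metric.ball_mem_nhds (0 : ℂ) one_pos] with q hq
    simpa [FormalMultilinearSeries.coeff_ofScalars] using hc q (by simpa using hq)
  have h := (key a ha).eq_formalMultilinearSeries (key b hb)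
  funext n
  simpa using congrArg (fun p => FormalMultilinearSeries.coeff p n) h

theorem dOdd_sub_dEven (n : ℕ) : (dOdd n : ℤ) - dEven n = falseThetaCoeff n := by
  have h := congrFun (eq_of_hasSum_pow_mul (fun q hq => hasSum_dOdd_sub_dEven hq)
    fun q hq => hasSum_falseThetaCoeff hq) n
  exact_mod_cast h

theorem theorem5p4 :
    (∀ q : ℂ, ‖q‖ < 1 →
      Summable (fun n : ℕ =>
        q ^ n * qPoch (q ^ (n + 1)) q n * qPochInf (q ^ (2 * n + 2)) (q ^ 2)) ∧
      Summable (fun j : ℕ =>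
        (-1 : ℂ) ^ j * q ^ (j * (3 * j + 2)) * (1 + q ^ (2 * j + 1))) ∧
      ∑' n : ℕ, q ^ n * qPoch (q ^ (n + 1)) q n * qPochInf (q ^ (2 * n + 2)) (q ^ 2) =
        ∑' j : ℕ, (-1 : ℂ) ^ j * q ^ (j * (3 * j + 2)) * (1 + q ^ (2 * j + 1))) ∧
    (∀ n : ℕ,
      (∀ j : ℕ, (n = 3 * j ^ 2 + 2 * j ∨ n = 3 * j ^ 2 + 4 * j + 1) →
        (dOdd n : ℤ) - (dEven n : ℤ) = (-1 : ℤ) ^ j) ∧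
      ((∀ j : ℕ, n ≠ 3 * j ^ 2 + 2 * j ∧ n ≠ 3 * j ^ 2 + 4 * j + 1) →
        (dOdd n : ℤ) - (dEven n : ℤ) = 0)) := by
  refine ⟨fun q hq => ?_, fun n => ⟨?_, fun h => ?_⟩⟩
  · have h1 := hasSum_qPoch_mul_qPochInf hq
    have h2 := hasSum_falseTheta hq
    exact ⟨h1.summable, h2.summable, h1.tsum_eq.trans h2.tsum_eq.symm⟩
  · have hk : ∀ k, (dOdd (falseThetaExponent k) : ℤ) - dEven (falseThetaExponent k) =
        (-1) ^ (k / 2) := fun k => by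
      rw [dOdd_sub_dEven, falseThetaCoeff, strictMono_falseThetaExponent.injective.extend_apply]
    rintro j (rfl | rfl)
    · simpa only [falseThetaExponent_two_mul, Nat.mul_div_cancel_left _ two_pos] using hk (2 * j)
    · simpa only [falseThetaExponent_two_mul_add_one, show (2 * j + 1) / 2 = j by omega]
        using hk (2 * j + 1)
  · rw [dOdd_sub_dEven, falseThetaCoeff, Function.extend_apply']
    · rfl
    rintro ⟨k, rfl⟩
    rcases Nat.even_or_odd' k with ⟨j, rfl | rfl⟩
    · exact (h j).1 (falseThetaExponent_two_mul j)
    · exact (h j).2 (falseThetaExponent_two_mul_add_one j)
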